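/- All graphs are finite, simple and have at least one vertex. The square $H^2$ of a graph $H$ is the graph on $V(H)$ in which two distinct vertices are adjacent iff their distance in $H$ is at most two; $H$ is a square root of $G$ if $H^2=G$. A graph is ptolemaic if $d(u,v)d(w,x)\le d(u,w)d(v,x)+d(u,x)d(v,w)$ for any four vertices $u,v,w,x$ of the same connected component, where $d$ is the distance in the graph. Write $N_G[v]$ for the closed neighborhood of $v$ in $G$. A graph is chordal if it has no induced cycle of length at least $4$; the gem is the path on four vertices plus a vertex adjacent to all of them. A gem-triple of $G$ is an ordered triple $(A,B,C)$ of distinct maximal cliques of $G$ with $A\cap C\ne\emptyset$, $A\cap C\subseteq B$, $A\cap B\not\subseteq C$ and $B\cap C\not\subseteq A$. Consider the following algorithm with input $G$. 1. If $G$ is not chordal, return "no ptolemaic square root". Otherwise compute the set $\mathcal C$ of maximal cliques of $G$ and let $H$ be the edgeless graph on $V(G)$. 2. For every gem-triple $(A,B,C)$ of $G$, add to $H$ all edges $uv$ with $u\in A\cap C$, $v\in (A\cup C)\cap B$, $u\neq v$ (the gem-triple edges). 3. For every $A\in\mathcal C$ let $\mathcal C_A=\{C\in\mathcal C: A\cap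 C\neq\emptyset\}$, $\mathcal C_A'=\{C\in\mathcal C:(A,B,C)\text{ is a gem-triple for some }B\}$, and $X_A=\bigcap(\mathcal C_A\setminus\mathcal C_A')\setminus\bigcup\mathcal C_A'$. 4. Choose an injective assignment $C\mapsto x_C$ on $\mathcal C$ with $x_C\in X_C$; if none exists, return "no ptolemaic square root". 5. For every $C\in\mathcal C$ add to $H$ all edges $vx_C$ with $v\in C\setminus\{x_C\}$ (the center edges). 6. If $H$ is a ptolemaic square root of $G$, return $H$; otherwise return "no ptolemaic square root". **Lemma.** Suppose that $G$ has a ptolemaic square root. Then, whichever injective assignment is chosen in step 4, the algorithm returns a graph $H$ that is a ptolemaic square root of $G$ and has the minimum number of edges among all ptolemaic square roots of $G$. The graph $H$ is chordal and gem-free, $N_H[x_C]=C$ for every $C\in\mathcal C$, and the edges of $H$ are exactly the gem-triple edges and the center edges. They are forced: for every ptolemaic square root $H'$ of $G$, all gem-triple edges are edges of $H'$, and there is a permutation $\sigma$ of $V(G)$ with $N_G[\sigma(v)]=N_G[v]$ for all $v$ (so $\sigma$ only relabels adjacent twins of $G$) such that the graph $\sigma(H')$ obtained from $H'$ by relabeling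 each $v$ as $\sigma(v)$ is a ptolemaic square root of $G$, satisfies $N_{\sigma(H')}[x_C]=C$ for all $C\in\mathcal C$, and contains all edges of $H$. Moreover, if some ptolemaic square root of $G$ is connected, then so is $H$. -/

import Mathlib

namespace PtolemaicRoot

/-- The closed neighbourhood `N_G[v]`. -/
def closedNbhd {V : Type*} (G : SimpleGraph V) (v : V) : Set V :=
  insert v (G.neighborSet v)

/-- The square of `H`: distinct vertices are adjacent iff their distance in `H` is at most two.
The extended distance is used, so vertices in different components are not adjacent. -/
def square {V : Type*} (H : SimpleGraph V) : SimpleGraph V where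
  Adj u v := u ≠ v ∧ H.edist u v ≤ 2
  symm := ⟨fun _ _ h => ⟨h.1.symm, by rw [SimpleGraph.edist_comm]; exact h.2⟩⟩
  loopless := ⟨fun _ h => h.1 rfl⟩

/-- The ptolemaic inequality for any four vertices of one connected component. For a connected
graph this is the inequality for all quadruples of vertices, see `isPtolemaic_iff_of_connected`. -/
def IsPtolemaic {V : Type*} (H : SimpleGraph V) : Prop :=
  ∀ u v w x : V, H.Reachable u v → H.Reachable u w → H.Reachable u x →
    H.dist u v * H.dist w x ≤ H.dist u w * H.dist v x + H.dist u x * H.dist v w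

theorem isPtolemaic_iff_of_connected {V : Type*} {H : SimpleGraph V} (hH : H.Connected) :
    IsPtolemaic H ↔ ∀ u v w x : V,
      H.dist u v * H.dist w x ≤ H.dist u w * H.dist v x + H.dist u x * H.dist v w :=
  ⟨fun h u v w x => h u v w x (hH u v) (hH u w) (hH u x), fun h u v w x _ _ _ => h u v w x⟩

/-- `H` is a square root of `G` and `H` is ptolemaic. -/
def IsPtolemaicSquareRoot {V : Type*} (H G : SimpleGraph V) : Prop :=
  IsPtolemaic H ∧ square H = G

/-- A graph is chordal if it has no induced cycle of length at least four. -/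
def IsChordal {V : Type*} (G : SimpleGraph V) : Prop :=
  ∀ l : ℕ, 4 ≤ l → ¬ (SimpleGraph.cycleGraph l).IsIndContained G

/-- The gem: the path `0 - 1 - 3 - 4` together with a vertex `2` adjacent to all of its vertices. -/
def gem : SimpleGraph (Fin 5) :=
  SimpleGraph.fromEdgeSet {s(0, 1), s(1, 3), s(3, 4), s(2, 0), s(2, 1), s(2, 3), s(2, 4)}

def IsGemFree {V : Type*} (G : SimpleGraph V) : Prop :=
  ¬ gem.IsIndContained G

/-- The set of all maximal (with respect to inclusion) cliques of `G`. -/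
def maximalCliques {V : Type*} (G : SimpleGraph V) : Set (Set V) :=
  {C | Maximal G.IsClique C}

structure IsGemTriple {V : Type*} (G : SimpleGraph V) (A B C : Set V) : Prop where
  left_mem : A ∈ maximalCliques G
  mid_mem : B ∈ maximalCliques G
  right_mem : C ∈ maximalCliques G
  left_ne_mid : A ≠ B
  mid_ne_right : B ≠ C
  left_ne_right : A ≠ C
  inter_nonempty : (A ∩ C).Nonempty
  inter_subset : A ∩ C ⊆ B
  left_not_subset : ¬ A ∩ B ⊆ C
  right_not_subset : ¬ B ∩ C ⊆ A

/-- The graph of all edges `uv` with `u ≠ v`, `u ∈ A ∩ C` and `v ∈ (A ∪ C) ∩ B` for some gem-triple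
`(A, B, C)` of `G`: the graph `H` after the gem-triple edges have been added. -/
def gemTripleGraph {V : Type*} (G : SimpleGraph V) : SimpleGraph V :=
  SimpleGraph.fromRel fun u v =>
    ∃ A B C : Set V, IsGemTriple G A B C ∧ u ∈ A ∩ C ∧ v ∈ (A ∪ C) ∩ B

/-- `𝒞_A`: the maximal cliques that meet `A`. -/
def meetingCliques {V : Type*} (G : SimpleGraph V) (A : Set V) : Set (Set V) :=
  {C | C ∈ maximalCliques G ∧ (A ∩ C).Nonempty}

/-- `𝒞_A'`: the maximal cliques `C` with `(A, B, C)` a gem-triple for some `B`. -/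
def gemTripleCliques {V : Type*} (G : SimpleGraph V) (A : Set V) : Set (Set V) :=
  {C | ∃ B : Set V, IsGemTriple G A B C}

/-- `X_A = ⋂ (𝒞_A \ 𝒞_A') \ ⋃ 𝒞_A'`: the candidates for a center of `A`. -/
def centerCandidates {V : Type*} (G : SimpleGraph V) (A : Set V) : Set V :=
  ⋂₀ (meetingCliques G A \ gemTripleCliques G A) \ ⋃₀ gemTripleCliques G A

/-- An injective assignment `C ↦ x_C ∈ X_C` on the maximal cliques of `G`. -/
def IsCenterAssignment {V : Type*} (G : SimpleGraph V) (x : maximalCliques G → V) : Prop :=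
  Function.Injective x ∧ ∀ C : maximalCliques G, x C ∈ centerCandidates G (C : Set V)

/-- The graph of all edges `v x_C` with `C` a maximal clique of `G`, `v ∈ C` and `v ≠ x_C`. -/
def centerGraph {V : Type*} (G : SimpleGraph V) (x : maximalCliques G → V) : SimpleGraph V :=
  SimpleGraph.fromRel fun u v => ∃ C : maximalCliques G, u ∈ (C : Set V) ∧ v = x C

/-- The graph `H` that the algorithm has built, for the assignment `x`, just before its last
check: first all gem-triple edges and then all center edges are added to the edgeless graph. -/
def builtGraph {V : Type*} (G : SimpleGraph V) (x : maximalCliques G → V) : SimpleGraph V :=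
  gemTripleGraph G ⊔ centerGraph G x

/-- `AlgorithmReturns G r`: some run of the algorithm on input `G` returns `r`, where `none` is the
answer "`G` has no ptolemaic square root". Runs differ only in the injective assignment that is
chosen. -/
inductive AlgorithmReturns {V : Type*} (G : SimpleGraph V) : Option (SimpleGraph V) → Prop
  /-- The input is not chordal. -/
  | not_chordal : ¬ IsChordal G → AlgorithmReturns G none
  /-- There is no injective assignment. -/
  | no_assignment : IsChordal G → (¬ ∃ x : maximalCliques G → V, IsCenterAssignment G x) →
      AlgorithmReturns G none
  /-- An injective assignment was chosen, but the final check fails. -/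
  | check_fails (x : maximalCliques G → V) : IsChordal G → IsCenterAssignment G x →
      ¬ IsPtolemaicSquareRoot (builtGraph G x) G → AlgorithmReturns G none
  /-- An injective assignment was chosen, and the final check succeeds. -/
  | check_succeeds (x : maximalCliques G → V) : IsChordal G → IsCenterAssignment G x →
      IsPtolemaicSquareRoot (builtGraph G x) G → AlgorithmReturns G (some (builtGraph G x))

end PtolemaicRoot

open PtolemaicRoot

/-!
Write `N_H[v]` for closed neighbourhoods and let `K` be a ptolemaic square root of `G`.

The structure of `K` is mostly read off from two instances of the ptolemaic inequality: a
path on four vertices whose ends have a common neighbour has a chord between vertices two steps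
apart (`IsPtolemaic.chord`), and a neighbour of `v` that is one step closer to `r` dominates all
neighbours of `v` that are not farther from `r` than `v`
(`IsPtolemaic.mem_closedNbhd_of_dist_le`). From them one gets, in every set `S`, a vertex whose
neighbours within `S` in the square all lie in one `N_K[s]` (`IsPtolemaic.exists_common_center`).
Hence `G = K²` is chordal and its maximal cliques are closed neighbourhoods `N_K[c]`; such a `c`
is called a center.

In terms of centers, a triple `(N_K[a], N_K[b], N_K[c])` is a gem-triple only if `a, c` are not
adjacent and `b` is adjacent to both; conversely, nonadjacent centers with a common neighbour
always extend to a gem-triple. So the gem-triple edges are forced, and `X_A` contains the centers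
of `A` in every square root and consists of twins in `G`. Any choice of the `x_C` is therefore
obtained from the centers of a given root by permuting twins. The relabelled root, again called
`K`, contains the built graph `H`, and `H² = G` since already the center edges generate `G`. This
gives minimality and connectedness at once.

It remains to see that `H` is ptolemaic. The distances in `H` and `K` agree except for the "light"
edges, those of `K` missing in `H`, whose ends have distance two in `H`
(`IsPtolemaicSquareRoot.dist_builtGraph_le`). For a light edge `u v`, a center adjacent to `u` and
`v` dominates both in `H` (`IsLight.closedNbhd_subset_of_center`), and so does every common
neighbour of `u` and `v` in `H` (`IsLight.closedNbhd_subset_of_common`). These two facts compare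
the distances of other vertices to `u` and to `v` closely enough for the ptolemaic inequality in
`H` to reduce to small arithmetic (`two_mul_le_of_light`). Finally, ptolemaic graphs are gem-free,
and they are chordal because their induced paths are geodesics
(`IsPtolemaic.dist_of_induced_path`).
-/

open PtolemaicRoot

namespace PtolemaicRoot

variable {V : Type*}

/-! ### Closed neighbourhoods and squares -/

theorem mem_closedNbhd {H : SimpleGraph V} {u v : V} :
    v ∈ closedNbhd H u ↔ v = u ∨ H.Adj u v := by
  simp [closedNbhd]

theorem self_mem_closedNbhd {H : SimpleGraph V} {u : V} : u ∈ closedNbhd H u :=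
  mem_closedNbhd.2 (.inl rfl)

theorem mem_closedNbhd_comm {H : SimpleGraph V} {u v : V} :
    v ∈ closedNbhd H u ↔ u ∈ closedNbhd H v := by
  rw [mem_closedNbhd, mem_closedNbhd, H.adj_comm, eq_comm]

theorem closedNbhd_mono {H K : SimpleGraph V} (h : H ≤ K) (v : V) :
    closedNbhd H v ⊆ closedNbhd K v :=
  Set.insert_subset_insert fun _ hw => h hw

theorem reachable_of_mem_closedNbhd {H : SimpleGraph V} {u v : V} (h : v ∈ closedNbhd H u) :
    H.Reachable u v := by
  rcases mem_closedNbhd.1 h with rfl | h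
  exacts [.rfl, h.reachable]

theorem mem_closedNbhd_iff_dist_le_one {H : SimpleGraph V} {u v : V} (h : H.Reachable u v) :
    v ∈ closedNbhd H u ↔ H.dist u v ≤ 1 := by
  rw [mem_closedNbhd, Nat.le_one_iff_eq_zero_or_eq_one, h.dist_eq_zero_iff,
    SimpleGraph.dist_eq_one_iff_adj, eq_comm]

theorem dist_le_one_of_mem_closedNbhd {H : SimpleGraph V} {u v : V} (h : v ∈ closedNbhd H u) :
    H.dist u v ≤ 1 :=
  (mem_closedNbhd_iff_dist_le_one (reachable_of_mem_closedNbhd h)).1 h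

theorem square_adj {H : SimpleGraph V} {u v : V} :
    (square H).Adj u v ↔ u ≠ v ∧ ∃ z, u ∈ closedNbhd H z ∧ v ∈ closedNbhd H z := by
  refine and_congr_right fun hne => ⟨fun h => ?_, fun ⟨z, hu, hv⟩ => ?_⟩
  · rcases h.eq_or_lt with h | h
    · obtain ⟨-, -, z, hz⟩ := SimpleGraph.edist_eq_two_iff.1 h
      rw [SimpleGraph.mem_commonNeighbors] at hz
      exact ⟨z, mem_closedNbhd.2 (.inr hz.1.symm), mem_closedNbhd.2 (.inr hz.2.symm)⟩
    · have : H.edist u v ≤ 1 := Order.le_of_lt_add_one (by simpa [one_add_one_eq_two] using h)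
      rcases SimpleGraph.edist_le_one_iff_adj_or_eq.1 this with h | h
      · exact ⟨u, self_mem_closedNbhd, mem_closedNbhd.2 (.inr h)⟩
      · exact absurd h hne
  · have key : ∀ {w}, w ∈ closedNbhd H z → H.edist z w ≤ 1 := fun hw =>
      SimpleGraph.edist_le_one_iff_adj_or_eq.2 ((mem_closedNbhd.1 hw).symm.imp_right Eq.symm)
    calc H.edist u v ≤ H.edist u z + H.edist z v := SimpleGraph.edist_triangle
      _ ≤ 1 + 1 := by
        rw [SimpleGraph.edist_comm (u := u)]
        exact add_le_add (key hu) (key hv)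
      _ = 2 := one_add_one_eq_two

theorem square_mono {H K : SimpleGraph V} (h : H ≤ K) : square H ≤ square K := by
  intro u v huv
  obtain ⟨hne, z, hu, hv⟩ := square_adj.1 huv
  exact square_adj.2 ⟨hne, z, closedNbhd_mono h z hu, closedNbhd_mono h z hv⟩

theorem reachable_square_iff {H : SimpleGraph V} {u v : V} :
    (square H).Reachable u v ↔ H.Reachable u v := by
  constructor
  · rintro ⟨p⟩
    induction p with
    | nil => exact .rfl
    | cons h _ ih =>
      obtain ⟨-, z, hu, hv⟩ := square_adj.1 h
      exact ((reachable_of_mem_closedNbhd hu).symm.trans (reachable_of_mem_closedNbhd hv)).trans ih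
  · exact SimpleGraph.Reachable.mono fun u v h =>
      square_adj.2 ⟨h.ne, u, self_mem_closedNbhd, mem_closedNbhd.2 (.inr h)⟩

theorem isClique_closedNbhd_square {H : SimpleGraph V} (v : V) :
    (square H).IsClique (closedNbhd H v) :=
  fun _ ha _ hb hne => square_adj.2 ⟨hne, v, ha, hb⟩

/-- If `w` dominates `u`, then a path from `u` to another vertex can be rerouted through `w` from
its second vertex on. -/
theorem dist_le_dist_of_closedNbhd_subset {H : SimpleGraph V} {u w x : V}
    (h : closedNbhd H u ⊆ closedNbhd H w) (hx : x ≠ u) (hr : H.Reachable u x) :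
    H.dist w x ≤ H.dist u x := by
  obtain ⟨p, hp⟩ := hr.exists_walk_length_eq_dist
  cases p with
  | nil => exact absurd rfl hx
  | @cons _ y _ huy p =>
    have hy : y ∈ closedNbhd H w := h (mem_closedNbhd.2 (.inr huy))
    have h1 := dist_le_one_of_mem_closedNbhd hy
    have h2 := (reachable_of_mem_closedNbhd hy).dist_triangle_left x
    have h3 := SimpleGraph.dist_le p
    rw [SimpleGraph.Walk.length_cons] at hp
    omega

/-! ### Ptolemaic graphs are chordal and gem-free -/

/-- If `a b c d` is a path with `d(a, c) = d(b, d) = 2`, then the ptolemaic inequality gives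
`4 ≤ 1 + d(a, d)`. Hence the path has a chord as soon as its ends have a
common neighbour; this excludes gems as well as induced cycles on four or five vertices, and the
vertices need not be distinct. -/
theorem IsPtolemaic.chord {H : SimpleGraph V} (hH : IsPtolemaic H) {a b c d z : V}
    (hab : b ∈ closedNbhd H a) (hbc : c ∈ closedNbhd H b) (hcd : d ∈ closedNbhd H c)
    (hza : a ∈ closedNbhd H z) (hzd : d ∈ closedNbhd H z) :
    c ∈ closedNbhd H a ∨ d ∈ closedNbhd H b := by
  have rab := reachable_of_mem_closedNbhd hab
  have rbc := reachable_of_mem_closedNbhd hbc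
  have rcd := reachable_of_mem_closedNbhd hcd
  rw [mem_closedNbhd_iff_dist_le_one (rab.trans rbc),
    mem_closedNbhd_iff_dist_le_one (rbc.trans rcd)]
  by_contra! hcon
  have key := hH a c b d (rab.trans rbc) rab (rab.trans (rbc.trans rcd))
  have h1 := dist_le_one_of_mem_closedNbhd hab
  have h2 := dist_le_one_of_mem_closedNbhd hbc
  have h3 := dist_le_one_of_mem_closedNbhd hcd
  have h4 := dist_le_one_of_mem_closedNbhd hza
  have h5 := dist_le_one_of_mem_closedNbhd hzd
  have h6 := (reachable_of_mem_closedNbhd hza).symm.dist_triangle_left d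
  rw [H.dist_comm (u := a) (v := z)] at h6
  rw [H.dist_comm (u := c) (v := b)] at key
  have h7 : H.dist a b * H.dist c d ≤ 1 * 1 := Nat.mul_le_mul h1 h3
  have h8 : H.dist a d * H.dist b c ≤ 2 * 1 := Nat.mul_le_mul (by omega) h2
  have h9 : 2 * 2 ≤ H.dist a c * H.dist b d := Nat.mul_le_mul hcon.1 hcon.2
  omega

theorem IsPtolemaic.isGemFree {H : SimpleGraph V} (hH : IsPtolemaic H) : IsGemFree H := by
  rintro ⟨f⟩
  have hadj : ∀ i j, f j ∈ closedNbhd H (f i) ↔ j = i ∨ gem.Adj i j := fun i j => by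
    rw [mem_closedNbhd, f.map_adj_iff, f.injective.eq_iff]
  rcases hH.chord ((hadj 0 1).2 (by simp [gem])) ((hadj 1 3).2 (by simp [gem]))
    ((hadj 3 4).2 (by simp [gem])) ((hadj 2 0).2 (by simp [gem])) ((hadj 2 4).2 (by simp [gem]))
    with h | h
  · simpa [gem] using (hadj 0 3).1 h
  · simpa [gem] using (hadj 1 4).1 h

/-- Induced paths of a ptolemaic graph are geodesics: if the two subpaths that miss an end have
length `n - 1 ≥ 2`, then `(n - 1) ^ 2 ≤ 1 + (n - 2) * d` for the distance `d` of the ends. -/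
theorem IsPtolemaic.dist_of_induced_path {H : SimpleGraph V} (hH : IsPtolemaic H)
    {p : ℕ → V} {m : ℕ}
    (hadj : ∀ i < m, H.Adj (p i) (p (i + 1)))
    (hind : ∀ i j, i + 2 ≤ j → j ≤ m → p j ∉ closedNbhd H (p i)) (n : ℕ) :
    ∀ i, i + n ≤ m → H.Reachable (p i) (p (i + n)) ∧ H.dist (p i) (p (i + n)) = n := by
  induction n using Nat.strong_induction_on with
  | _ n ih =>
    intro i hi
    match n, ih, hi with
    | 0, _, _ => simp
    | 1, _, hi => exact ⟨(hadj i hi).reachable, SimpleGraph.dist_eq_one_iff_adj.2 (hadj i hi)⟩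
    | n + 2, ih, hi =>
      obtain ⟨r1, d1⟩ := ih (n + 1) (by omega) i (by omega)
      obtain ⟨r2, d2⟩ := ih (n + 1) (by omega) (i + 1) (by omega)
      obtain ⟨r3, d3⟩ := ih n (by omega) (i + 1) (by omega)
      obtain ⟨r4, d4⟩ := ih 1 (by omega) i (by omega)
      obtain ⟨r5, d5⟩ := ih 1 (by omega) (i + (n + 1)) (by omega)
      rw [show i + 1 + (n + 1) = i + (n + 2) by omega] at r2 d2
      rw [show i + 1 + n = i + (n + 1) by omega] at r3 d3
      rw [show i + (n + 1) + 1 = i + (n + 2) by omega] at r5 d5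
      have hr := r4.trans r2
      refine ⟨hr, ?_⟩
      have hup := r4.dist_triangle_left (p (i + (n + 2)))
      have hlow := hind i (i + (n + 2)) (by omega) hi
      rw [mem_closedNbhd_iff_dist_le_one hr] at hlow
      have key := hH (p i) (p (i + (n + 1))) (p (i + 1)) (p (i + (n + 2))) r1 r4 hr
      rw [H.dist_comm (u := p (i + (n + 1))) (v := p (i + 1)), d1, d2, d3, d4, d5] at key
      by_contra hne
      have : H.dist (p i) (p (i + (n + 2))) ≤ n + 1 := by omega
      have h8 := Nat.mul_le_mul_right n this
      have : n ≠ 0 := by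
        rintro rfl
        omega
      have : 1 ≤ n := by omega
      nlinarith

theorem IsPtolemaic.isChordal {H : SimpleGraph V} (hH : IsPtolemaic H) : IsChordal H := by
  rintro l hl ⟨f⟩
  have : NeZero l := ⟨by omega⟩
  have hval : ∀ i < l, (Fin.ofNat l i).val = i := fun i hi => by simp [Nat.mod_eq_of_lt hi]
  have hsub : ∀ i j, i ≤ j → j < l → (Fin.ofNat l j - Fin.ofNat l i).val = j - i := by
    intro i j hij hj
    rw [Fin.sub_val_of_le, hval j hj, hval i (by omega)]
    rw [Fin.le_def, hval j hj, hval i (by omega)]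
    exact hij
  have hsub' : ∀ i j, i < j → j < l → (Fin.ofNat l i - Fin.ofNat l j).val = l - (j - i) := by
    intro i j hij hj
    rw [Fin.coe_sub_iff_lt.2, hval j hj, hval i (by omega)]
    · omega
    · rw [Fin.lt_def, hval j hj, hval i (by omega)]
      exact hij
  -- the vertices of the cycle in cyclic order; those of index at most `l - 2` form an
  -- induced path
  set p : ℕ → V := fun i => f (Fin.ofNat l i) with hp
  have hpadj : ∀ i j, i < j → j < l →
      (p j ∈ closedNbhd H (p i) ↔ j = i + 1 ∨ i = 0 ∧ j + 1 = l) := by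
    intro i j hij hj
    have hne : Fin.ofNat l j ≠ Fin.ofNat l i := fun h => by
      have := congrArg Fin.val h
      rw [hval j hj, hval i (by omega)] at this
      omega
    rw [mem_closedNbhd, f.map_adj_iff, f.injective.eq_iff, SimpleGraph.cycleGraph_adj',
      hsub i j hij.le hj, hsub' i j hij hj]
    simp only [hne, false_or]
    omega
  have hind := hH.dist_of_induced_path (p := p) (m := l - 2)
    (fun i hi => (mem_closedNbhd.1
      ((hpadj i (i + 1) (by omega) (by omega)).2 (.inl rfl))).resolve_left fun h => by
        have := congrArg Fin.val (f.injective h)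
        rw [hval _ (by omega), hval _ (by omega)] at this
        omega)
    (fun i j hij hj => by rw [hpadj i j (by omega) (by omega)]; omega) (l - 2) 0 (by omega)
  have h1 := (hpadj 0 (l - 1) (by omega) (by omega)).2 (.inr (by omega))
  have h2 := (hpadj (l - 2) (l - 1) (by omega) (by omega)).2 (.inl (by omega))
  rcases hl.eq_or_lt with rfl | hl
  · -- four vertices: here the path on all of them is closed up by an edge
    rcases hH.chord ((hpadj 0 1 (by omega) (by omega)).2 (by omega))
      ((hpadj 1 2 (by omega) (by omega)).2 (by omega))
      ((hpadj 2 3 (by omega) (by omega)).2 (by omega))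
      self_mem_closedNbhd h1 with h | h
    · rw [hpadj 0 2 (by omega) (by omega)] at h
      omega
    · rw [hpadj 1 3 (by omega) (by omega)] at h
      omega
  · have h3 := (reachable_of_mem_closedNbhd h1).dist_triangle_left (p (l - 2))
    have h4 := dist_le_one_of_mem_closedNbhd h1
    have h5 := dist_le_one_of_mem_closedNbhd h2
    rw [H.dist_comm] at h5
    rw [zero_add] at hind
    have := hind.2
    omega

/-! ### Maximal cliques of the square of a ptolemaic graph -/

theorem exists_adj_dist_succ {H : SimpleGraph V} {r v : V} (hr : H.Reachable r v) (hne : r ≠ v) :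
    ∃ s, H.Adj s v ∧ H.dist r s + 1 = H.dist r v := by
  obtain ⟨p, hp⟩ := hr.symm.exists_walk_length_eq_dist
  cases p with
  | nil => exact absurd rfl hne
  | @cons _ s _ hs p =>
    refine ⟨s, hs.symm, ?_⟩
    have h1 := SimpleGraph.dist_le p
    have h2 := hs.reachable.dist_triangle_left r
    rw [SimpleGraph.dist_eq_one_iff_adj.2 hs] at h2
    rw [SimpleGraph.Walk.length_cons] at hp
    rw [H.dist_comm (u := r), H.dist_comm (u := r)]
    omega

/-- The neighbours of `v` that are one step closer to `r` dominate all neighbours of `v` that are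
not farther from `r` than `v`: with `k = d(r, v)` the ptolemaic inequality gives
`k * d(s, a) ≤ (k - 1) + k`. -/
theorem IsPtolemaic.mem_closedNbhd_of_dist_le {H : SimpleGraph V} (hH : IsPtolemaic H) {r v s a : V}
    (hr : H.Reachable r v) (hs : H.Adj s v) (hsd : H.dist r s + 1 = H.dist r v)
    (ha : a ∈ closedNbhd H v) (had : H.dist r a ≤ H.dist r v) : a ∈ closedNbhd H s := by
  rcases mem_closedNbhd.1 ha with rfl | ha
  · exact mem_closedNbhd.2 (.inr hs)
  have hrs := hr.trans hs.symm.reachable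
  rw [mem_closedNbhd_iff_dist_le_one (hs.reachable.trans ha.reachable)]
  have key := hH r v s a hr hrs (hr.trans ha.reachable)
  rw [SimpleGraph.dist_eq_one_iff_adj.2 ha, SimpleGraph.dist_eq_one_iff_adj.2 hs.symm] at key
  by_contra! hcon
  have : H.dist r v * 2 ≤ H.dist r v * H.dist s a := Nat.mul_le_mul_left _ hcon
  omega

/-- In every set `S` some vertex `v` is simplicial for the square, in the strong sense that all
members of `S` at distance at most two from `v` lie in one closed neighbourhood `N[s]`.

Fix `r ∈ S` and take `v` in the component of `r`, at maximum distance `k` from `r`, and with as few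
neighbours at distance `k - 1` from `r` as possible; any of these serves as `s`. -/
theorem IsPtolemaic.exists_common_center [Finite V] {H : SimpleGraph V} (hH : IsPtolemaic H)
    {S : Set V} (hS : S.Nonempty) :
    ∃ v ∈ S, ∃ s, ∀ a ∈ S, ∀ z, v ∈ closedNbhd H z → a ∈ closedNbhd H z → a ∈ closedNbhd H s := by
  obtain ⟨r, hrS⟩ := hS
  obtain ⟨v₀, ⟨hv₀S, hv₀⟩, hv₀max⟩ := Set.exists_max_image {v | v ∈ S ∧ H.Reachable r v} (H.dist r)
    (Set.toFinite _) ⟨r, hrS, .rfl⟩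
  let down : V → Set V := fun v => {s | H.Adj s v ∧ H.dist r s + 1 = H.dist r v}
  obtain ⟨v, ⟨hvS, hv, hvk⟩, hvmin⟩ := Set.exists_min_image
    {v | v ∈ S ∧ H.Reachable r v ∧ H.dist r v = H.dist r v₀} (fun v => (down v).ncard)
    (Set.toFinite _) ⟨v₀, hv₀S, hv₀, rfl⟩
  have hmax : ∀ a ∈ S, H.Reachable r a → H.dist r a ≤ H.dist r v := fun a ha hra =>
    hvk ▸ hv₀max a ⟨ha, hra⟩
  by_cases hrv : r = v
  · -- `S` has no other vertex in the component of `r`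
    subst hrv
    refine ⟨r, hrS, r, fun a ha z hz haz => ?_⟩
    have hra := (reachable_of_mem_closedNbhd hz).symm.trans (reachable_of_mem_closedNbhd haz)
    have := hmax a ha hra
    rw [SimpleGraph.dist_self, Nat.le_zero, hra.dist_eq_zero_iff] at this
    exact this ▸ self_mem_closedNbhd
  obtain ⟨s, hs, hsd⟩ := exists_adj_dist_succ hv hrv
  refine ⟨v, hvS, s, fun a ha z hz haz => ?_⟩
  by_contra has
  have dom := @IsPtolemaic.mem_closedNbhd_of_dist_le _ _ hH
  have hra : H.Reachable r a :=
    (hv.trans (reachable_of_mem_closedNbhd hz).symm).trans (reachable_of_mem_closedNbhd haz)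
  have hka := hmax a ha hra
  have hav : a ∉ closedNbhd H v := fun h => has (dom hv hs hsd h hka)
  have adj : ∀ {x y}, y ∈ closedNbhd H x → H.dist r x ≠ H.dist r y → H.Adj x y := fun h hne =>
    (mem_closedNbhd.1 h).resolve_left fun h => hne (h ▸ rfl)
  have level : ∀ {x y}, y ∈ closedNbhd H x → H.dist r y ≤ H.dist r x + 1 := fun {x y} h => by
    have := (reachable_of_mem_closedNbhd h).dist_triangle_right r
    have := dist_le_one_of_mem_closedNbhd h
    omega
  have hvz := mem_closedNbhd_comm.1 hz
  have hza := mem_closedNbhd_comm.1 haz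
  have hrz : H.Reachable r z := hv.trans (reachable_of_mem_closedNbhd hvz)
  have hzk : H.dist r z ≤ H.dist r v := by
    by_contra! h
    have := level hvz
    exact hav (dom hrz (adj hvz (by omega)) (by omega) haz (by omega))
  have l1 := level hz
  have l2 := level haz
  have l3 := level hza
  have hsv : s ∈ closedNbhd H v := mem_closedNbhd.2 (.inr hs.symm)
  rcases hka.lt_or_eq with hlt | hka
  · -- `a` is closer to `r` than `v`, so `z` is one of the neighbours of `v` nearer to `r`
    have hz1 : H.dist r z + 1 = H.dist r v := by
      by_contra h
      exact hav (mem_closedNbhd_comm.1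
        (dom hrz (adj hza (by omega)) (by omega) hz (by omega)))
    have hsz : s ∈ closedNbhd H z := dom hv (adj hz (by omega)) hz1 hsv (by omega)
    by_cases hd : H.dist r a = H.dist r z
    · have hne : r ≠ z := by
        rintro rfl
        rw [SimpleGraph.dist_self, hra.dist_eq_zero_iff] at hd
        exact hav (hd ▸ hvz)
      obtain ⟨w, hw, hwd⟩ := exists_adj_dist_succ hrz hne
      have hwa := dom hrz hw hwd haz (by omega)
      have hws := dom hrz hw hwd hsz (by omega)
      rcases hH.chord hsv (mem_closedNbhd_comm.1 hws) hwa hz haz with h | h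
      · have := level (mem_closedNbhd_comm.1 h)
        omega
      · exact has h
    · exact has (mem_closedNbhd_comm.1
        (dom hrz (adj hza (by omega)) (by omega) hsz (by omega)))
  · -- `a` and `v` have the same distance from `r`: here the minimality of `v` is needed
    obtain ⟨q, ⟨hqa, hqd⟩, hqv⟩ : ∃ q ∈ down a, q ∉ down v := by
      by_contra! hsub
      have heq := Set.eq_of_subset_of_ncard_le hsub (hvmin a ⟨ha, hra, hka.trans hvk⟩)
      have hsa : s ∈ down a := heq ▸ ⟨hs, hsd⟩
      exact has (mem_closedNbhd.2 (.inr hsa.1))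
    obtain ⟨t, htv, hta, htd⟩ : ∃ t, H.Adj t v ∧ H.Adj t a ∧ H.dist r t + 1 = H.dist r v := by
      by_cases hd : H.dist r z = H.dist r v
      · obtain ⟨t, ht, htd⟩ := exists_adj_dist_succ hrz (by
          rintro rfl
          rw [SimpleGraph.dist_self] at hd
          omega)
        exact ⟨t, adj (dom hrz ht htd hz hd.ge) (by omega),
          adj (dom hrz ht htd haz (by omega)) (by omega), by omega⟩
      · exact ⟨z, adj hz hd, adj haz (by omega), by omega⟩
    have hqv' : q ∉ closedNbhd H v := fun h => hqv
      ⟨(adj h (by omega)).symm, by omega⟩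
    have hrt : H.Reachable r t := hv.trans htv.symm.reachable
    have hvt : v ∈ closedNbhd H t := mem_closedNbhd.2 (.inr htv)
    have hat : a ∈ closedNbhd H t := mem_closedNbhd.2 (.inr hta)
    have hts : s ∈ closedNbhd H t := dom hv htv htd hsv (by omega)
    have htq : q ∈ closedNbhd H t :=
      dom hra hta (by omega) (mem_closedNbhd.2 (.inr hqa.symm)) (by omega)
    have hsq : q ∉ closedNbhd H s := fun h => by
      rcases hH.chord hsv h (mem_closedNbhd.2 (.inr hqa)) hvt hat with h | h
      exacts [hqv' h, has h]
    have hne : r ≠ t := by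
      rintro rfl
      have h0 : H.dist r s = 0 := by
        rw [SimpleGraph.dist_self] at htd
        omega
      rw [(hv.trans hs.symm.reachable).dist_eq_zero_iff] at h0
      exact has (h0 ▸ hat)
    obtain ⟨w, hw, hwd⟩ := exists_adj_dist_succ hrt hne
    rcases hH.chord hsv (mem_closedNbhd_comm.1 (dom hrt hw hwd hts (by omega)))
      (dom hrt hw hwd htq (by omega)) hvt htq with h | h
    · have := level (mem_closedNbhd_comm.1 h)
      omega
    · exact hsq h

theorem isClique_subset_maximal [Finite V] {G : SimpleGraph V} {S : Set V} (hS : G.IsClique S) :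
    ∃ C ∈ maximalCliques G, S ⊆ C := by
  obtain ⟨C, hSC, hC⟩ := Finite.exists_le_maximal (p := G.IsClique) hS
  exact ⟨C, hC, hSC⟩

theorem nonempty_of_mem_maximalCliques [Nonempty V] {G : SimpleGraph V} {C : Set V}
    (hC : C ∈ maximalCliques G) : C.Nonempty := by
  by_contra h
  rw [Set.not_nonempty_iff_eq_empty] at h
  subst h
  obtain ⟨v⟩ := ‹Nonempty V›
  exact hC.2 (y := {v}) (by simp) (Set.empty_subset _) rfl

theorem subset_closedNbhd_of_mem {G : SimpleGraph V} {C : Set V} (hC : C ∈ maximalCliques G) {v : V}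
    (hv : v ∈ C) : C ⊆ closedNbhd G v := fun w hw => by
  rw [mem_closedNbhd]
  by_cases h : w = v
  exacts [.inl h, .inr (hC.1 hv hw (Ne.symm h))]

theorem mem_maximalClique_iff {G : SimpleGraph V} {C : Set V} (hC : C ∈ maximalCliques G) {v : V} :
    v ∈ C ↔ C ⊆ closedNbhd G v := by
  refine ⟨subset_closedNbhd_of_mem hC, fun h => ?_⟩
  refine hC.2 (y := insert v C) ?_ (Set.subset_insert _ _) (Set.mem_insert _ _)
  refine SimpleGraph.isClique_insert.2 ⟨hC.1, fun w hw hne => ?_⟩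
  exact (mem_closedNbhd.1 (h hw)).resolve_left (Ne.symm hne)

theorem IsPtolemaicSquareRoot.exists_center [Finite V] [Nonempty V] {H G : SimpleGraph V}
    (hH : IsPtolemaicSquareRoot H G) {C : Set V} (hC : C ∈ maximalCliques G) :
    ∃ c, closedNbhd H c = C := by
  obtain ⟨hH, rfl⟩ := hH
  obtain ⟨v, hv, s, hs⟩ := hH.exists_common_center (nonempty_of_mem_maximalCliques hC)
  have hsub : C ⊆ closedNbhd H s := fun a ha => by
    by_cases hav : v = a
    · subst hav
      exact hs v ha v self_mem_closedNbhd self_mem_closedNbhd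
    · obtain ⟨-, z, hz, haz⟩ := square_adj.1 (hC.1 hv ha hav)
      exact hs a ha z hz haz
  exact ⟨s, hsub.antisymm' (hC.2 (isClique_closedNbhd_square s) hsub)⟩

theorem IsPtolemaicSquareRoot.isChordal [Finite V] {H G : SimpleGraph V}
    (hH : IsPtolemaicSquareRoot H G) : IsChordal G := by
  obtain ⟨hH, rfl⟩ := hH
  rintro l hl ⟨f⟩
  obtain ⟨n, rfl⟩ := Nat.exists_eq_add_of_le' hl
  obtain ⟨_, ⟨i, rfl⟩, s, hs⟩ := hH.exists_common_center (Set.range_nonempty f)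
  have near : ∀ j, (SimpleGraph.cycleGraph (n + 4)).Adj i j → f j ∈ closedNbhd H s :=
    fun j hij => by
      obtain ⟨-, z, hz, hjz⟩ := square_adj.1 (f.map_adj_iff.2 hij)
      exact hs _ ⟨j, rfl⟩ z hz hjz
  have h1 := near (i + 1) (by simp [SimpleGraph.cycleGraph_adj])
  have h2 := near (i - 1) (by simp [SimpleGraph.cycleGraph_adj])
  have htwo : (1 + 1 : Fin (n + 4)).val = 2 := by
    rw [Fin.val_add, Fin.val_one, Nat.mod_eq_of_lt (by omega)]
  have hthree : (1 + 1 + 1 : Fin (n + 4)).val = 3 := by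
    rw [Fin.val_add, htwo, Fin.val_one, Nat.mod_eq_of_lt (by omega)]
  have hsub : i + 1 - (i - 1) = 1 + 1 := add_sub_sub_cancel i 1 1
  have hne : i + 1 ≠ i - 1 := fun h => by
    rw [h, sub_self] at hsub
    simp [← hsub] at htwo
  have := f.map_adj_iff.1 (square_adj.2 ⟨f.injective.ne hne, s, h1, h2⟩)
  rw [SimpleGraph.cycleGraph_adj, ← neg_sub (i + 1), hsub] at this
  rcases this with h | h
  · simp [h] at htwo
  · rw [neg_eq_iff_add_eq_zero.1 h] at hthree
    simp at hthree

/-! ### Gem-triples and centers -/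

/-- `c` selects for every maximal clique `C` of `G` a center in `H`, that is, a vertex whose closed
neighbourhood in `H` is `C`. -/
def IsCenterMap (H G : SimpleGraph V) (c : maximalCliques G → V) : Prop :=
  ∀ C : maximalCliques G, closedNbhd H (c C) = C

theorem IsPtolemaicSquareRoot.exists_isCenterMap [Finite V] [Nonempty V] {H G : SimpleGraph V}
    (hH : IsPtolemaicSquareRoot H G) : ∃ c, IsCenterMap H G c :=
  ⟨fun C => (hH.exists_center C.2).choose, fun C => (hH.exists_center C.2).choose_spec⟩

theorem IsCenterMap.injective {H G : SimpleGraph V} {c : maximalCliques G → V}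
    (hc : IsCenterMap H G c) : Function.Injective c := fun C D h =>
  Subtype.ext (by rw [← hc C, ← hc D, h])

theorem IsGemTriple.symm {G : SimpleGraph V} {A B C : Set V} (h : IsGemTriple G A B C) :
    IsGemTriple G C B A where
  left_mem := h.right_mem
  mid_mem := h.mid_mem
  right_mem := h.left_mem
  left_ne_mid := h.mid_ne_right.symm
  mid_ne_right := h.left_ne_mid.symm
  left_ne_right := h.left_ne_right.symm
  inter_nonempty := Set.inter_comm A C ▸ h.inter_nonempty
  inter_subset := Set.inter_comm A C ▸ h.inter_subset
  left_not_subset := Set.inter_comm B C ▸ h.right_not_subset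
  right_not_subset := Set.inter_comm A B ▸ h.left_not_subset

/-- The outer centers of a gem-triple are not adjacent. -/
theorem IsPtolemaic.notMem_of_isGemTriple {H G : SimpleGraph V} (hH : IsPtolemaic H) {a b c : V}
    (h : IsGemTriple G (closedNbhd H a) (closedNbhd H b) (closedNbhd H c)) :
    c ∉ closedNbhd H a := fun hac => by
  obtain ⟨p, ⟨hpa, hpb⟩, hpc⟩ := Set.not_subset.1 h.left_not_subset
  obtain ⟨q, ⟨hqb, hqc⟩, hqa⟩ := Set.not_subset.1 h.right_not_subset
  rcases hH.chord (mem_closedNbhd_comm.1 hpa) hac hqc hpb hqb with h | h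
  exacts [hpc (mem_closedNbhd_comm.1 h), hqa h]

/-- The center of the middle clique of a gem-triple is adjacent to both outer centers: otherwise
the closed walk through the three centers and members of `A ∩ B \ C`, `B ∩ C \ A` and `A ∩ C` has
too few chords. -/
theorem IsPtolemaic.mem_inter_of_isGemTriple {H G : SimpleGraph V} (hH : IsPtolemaic H) {a b c : V}
    (h : IsGemTriple G (closedNbhd H a) (closedNbhd H b) (closedNbhd H c)) :
    b ∈ closedNbhd H a ∩ closedNbhd H c := by
  obtain ⟨u, hua, huc⟩ := h.inter_nonempty
  have hub := h.inter_subset ⟨hua, huc⟩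
  obtain ⟨p, ⟨hpa, hpb⟩, hpc⟩ := Set.not_subset.1 h.left_not_subset
  obtain ⟨q, ⟨hqb, hqc⟩, hqa⟩ := Set.not_subset.1 h.right_not_subset
  rw [mem_closedNbhd_comm] at hua huc hub
  have hpa' := mem_closedNbhd_comm.1 hpa
  have hpb' := mem_closedNbhd_comm.1 hpb
  have hqb' := mem_closedNbhd_comm.1 hqb
  have hqc' := mem_closedNbhd_comm.1 hqc
  have hpc' := mt mem_closedNbhd_comm.1 hpc
  have hqa' := mt mem_closedNbhd_comm.1 hqa
  by_cases ha : b ∈ closedNbhd H a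
  · refine ⟨ha, ?_⟩
    by_contra hc
    rcases hH.chord ha hqb hqc' hua huc with h | h
    exacts [hqa h, hc (mem_closedNbhd_comm.1 h)]
  by_cases hc : b ∈ closedNbhd H c
  · rcases hH.chord hc hpb hpa' huc hua with h | h
    exacts [absurd h hpc, absurd (mem_closedNbhd_comm.1 h) ha]
  have hqu : u ∈ closedNbhd H q := by
    rcases hH.chord hqb hqc' (mem_closedNbhd_comm.1 huc) hub self_mem_closedNbhd with h | h
    exacts [absurd (mem_closedNbhd_comm.1 h) hc, h]
  have hqp : q ∈ closedNbhd H p := by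
    rcases hH.chord hpa hpb' hqb hua (mem_closedNbhd_comm.1 hqu) with h | h
    exacts [absurd h ha, h]
  rcases hH.chord hpa hqp hqc' hua huc with h | h
  exacts [absurd h hqa, absurd h hpc']

/-- The gem-triple edges belong to every ptolemaic square root. -/
theorem IsPtolemaicSquareRoot.gemTripleGraph_le [Finite V] [Nonempty V] {H G : SimpleGraph V}
    (hH : IsPtolemaicSquareRoot H G) : gemTripleGraph G ≤ H := by
  have key : ∀ A B C : Set V, IsGemTriple G A B C → ∀ u ∈ A ∩ C, ∀ v ∈ A ∩ B,
      v ∈ closedNbhd H u := by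
    rintro A B C h u ⟨hua, huc⟩ v ⟨hva, hvb⟩
    obtain ⟨a, rfl⟩ := hH.exists_center h.left_mem
    obtain ⟨b, rfl⟩ := hH.exists_center h.mid_mem
    obtain ⟨c, rfl⟩ := hH.exists_center h.right_mem
    rcases hH.1.chord (mem_closedNbhd_comm.1 hva) hua (mem_closedNbhd_comm.1 huc) hvb
      (mem_closedNbhd_comm.1 (hH.1.mem_inter_of_isGemTriple h).2) with h' | h'
    exacts [mem_closedNbhd_comm.1 h', absurd h' (hH.1.notMem_of_isGemTriple h)]
  have key' : ∀ u v, (∃ A B C : Set V, IsGemTriple G A B C ∧ u ∈ A ∩ C ∧ v ∈ (A ∪ C) ∩ B) →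
      v ∈ closedNbhd H u := by
    rintro u v ⟨A, B, C, h, hu, hv | hv, hvB⟩
    exacts [key A B C h u hu v ⟨hv, hvB⟩, key C B A h.symm u hu.symm v ⟨hv, hvB⟩]
  intro u v huv
  obtain ⟨hne, h | h⟩ := (SimpleGraph.fromRel_adj _ _ _).1 huv
  · exact (mem_closedNbhd.1 (key' u v h)).resolve_left hne.symm
  · exact ((mem_closedNbhd.1 (key' v u h)).resolve_left hne).symm

/-- Two nonadjacent centers and a common neighbour `u` give a gem-triple, with any maximal clique
that contains `N[u]` in the middle. -/
theorem IsPtolemaicSquareRoot.isGemTriple {H G : SimpleGraph V} (hH : IsPtolemaicSquareRoot H G)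
    {a c u : V} {B : Set V} (ha : closedNbhd H a ∈ maximalCliques G)
    (hc : closedNbhd H c ∈ maximalCliques G) (hB : B ∈ maximalCliques G)
    (hua : u ∈ closedNbhd H a) (huc : u ∈ closedNbhd H c) (hac : c ∉ closedNbhd H a)
    (hsub : closedNbhd H u ⊆ B) : IsGemTriple G (closedNbhd H a) B (closedNbhd H c) := by
  have hca := mt mem_closedNbhd_comm.1 hac
  have haB := hsub (mem_closedNbhd_comm.1 hua)
  have hcB := hsub (mem_closedNbhd_comm.1 huc)
  refine ⟨ha, hB, hc, ?_, ?_, ?_, ⟨u, hua, huc⟩, ?_, ?_, ?_⟩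
  · rintro rfl
    exact hac hcB
  · rintro rfl
    exact hca haB
  · intro h
    exact hac (h ▸ self_mem_closedNbhd)
  · rintro y ⟨hya, hyc⟩
    rcases hH.1.chord hua (mem_closedNbhd_comm.1 huc) hyc self_mem_closedNbhd hya with h | h
    exacts [absurd h hac, hsub h]
  · exact fun h => hca (h ⟨self_mem_closedNbhd, haB⟩)
  · exact fun h => hac (h ⟨hcB, self_mem_closedNbhd⟩)

/-- For a center `a` of `A` the members of `𝒞_A'` are the members of `𝒞_A` that do not contain
`a`, so that `a` is a candidate. -/
theorem IsPtolemaicSquareRoot.mem_centerCandidates [Finite V] [Nonempty V] {H G : SimpleGraph V}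
    (hH : IsPtolemaicSquareRoot H G) {a : V} (ha : closedNbhd H a ∈ maximalCliques G) :
    a ∈ centerCandidates G (closedNbhd H a) := by
  constructor
  · rintro D ⟨⟨hD, u, hua, huD⟩, hgem⟩
    obtain ⟨d, rfl⟩ := hH.exists_center hD
    by_contra had
    obtain ⟨B, hB, hsub⟩ := isClique_subset_maximal (G := G) (S := closedNbhd H u)
      (hH.2 ▸ isClique_closedNbhd_square u)
    exact hgem ⟨B, hH.isGemTriple ha hD hB hua huD (mt mem_closedNbhd_comm.1 had) hsub⟩
  · rintro ⟨D, ⟨B, h⟩, haD⟩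
    obtain ⟨b, rfl⟩ := hH.exists_center h.mid_mem
    obtain ⟨d, rfl⟩ := hH.exists_center h.right_mem
    exact hH.1.notMem_of_isGemTriple h (mem_closedNbhd_comm.1 haD)

theorem mem_maximalClique_iff_of_mem_centerCandidates {G : SimpleGraph V} {A D : Set V} {y : V}
    (hA : A ∈ maximalCliques G) (hne : A.Nonempty) (hy : y ∈ centerCandidates G A)
    (hD : D ∈ maximalCliques G) :
    y ∈ D ↔ D ∈ meetingCliques G A \ gemTripleCliques G A := by
  have hyA : y ∈ A := hy.1 A ⟨⟨hA, by rwa [Set.inter_self]⟩, fun ⟨_, h⟩ => h.left_ne_right rfl⟩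
  exact ⟨fun h => ⟨⟨hD, y, hyA, h⟩, fun hgem => hy.2 ⟨D, hgem, h⟩⟩, fun h => hy.1 D h⟩

theorem mem_closedNbhd_iff_exists_maximalClique [Finite V] {G : SimpleGraph V} {u v : V} :
    v ∈ closedNbhd G u ↔ ∃ D ∈ maximalCliques G, u ∈ D ∧ v ∈ D := by
  constructor
  · intro h
    obtain ⟨D, hD, hsub⟩ := isClique_subset_maximal (G := G) (S := {u, v})
      (SimpleGraph.isClique_pair.2 fun hne => (mem_closedNbhd.1 h).resolve_left hne.symm)
    exact ⟨D, hD, hsub (.inl rfl), hsub (.inr rfl)⟩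
  · rintro ⟨D, hD, hu, hv⟩
    exact subset_closedNbhd_of_mem hD hu hv

/-- The candidates for a center of `A` are twins of each other in `G`. -/
theorem closedNbhd_eq_of_mem_centerCandidates [Finite V] [Nonempty V] {G : SimpleGraph V}
    {A : Set V} {y z : V} (hA : A ∈ maximalCliques G) (hy : y ∈ centerCandidates G A)
    (hz : z ∈ centerCandidates G A) : closedNbhd G y = closedNbhd G z := by
  ext v
  have hne := nonempty_of_mem_maximalCliques hA
  simp only [mem_closedNbhd_iff_exists_maximalClique]
  refine exists_congr fun D => and_congr_right fun hD => and_congr_left fun _ => ?_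
  rw [mem_maximalClique_iff_of_mem_centerCandidates hA hne hy hD,
    mem_maximalClique_iff_of_mem_centerCandidates hA hne hz hD]

theorem IsPtolemaicSquareRoot.isCenterAssignment [Finite V] [Nonempty V] {H G : SimpleGraph V}
    (hH : IsPtolemaicSquareRoot H G) {c : maximalCliques G → V} (hc : IsCenterMap H G c) :
    IsCenterAssignment G c :=
  ⟨hc.injective, fun C => by
    have := hH.mem_centerCandidates (a := c C) (hc C ▸ C.2)
    rwa [hc C] at this⟩

/-! ### Relabelling twins -/

/-- An injective choice of points can be moved to any other one by a permutation that preserves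
`f`, as long as `f` does not distinguish the two choices. -/
theorem exists_perm_of_injective {ι β : Type*} [Finite ι] (f : V → β) {c x : ι → V}
    (hc : Function.Injective c) (hx : Function.Injective x) (hf : ∀ i, f (x i) = f (c i)) :
    ∃ σ : Equiv.Perm V, (∀ v, f (σ v) = f v) ∧ ∀ i, σ (c i) = x i := by
  classical
  have key : ∀ T : Set ι, T.Finite →
      ∃ σ : Equiv.Perm V, (∀ v, f (σ v) = f v) ∧ ∀ i ∈ T, σ (c i) = x i := by
    intro T hT
    induction T, hT using Set.Finite.induction_on with
    | empty => exact ⟨1, fun _ => rfl, by simp⟩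
    | @insert j T hj _ ih =>
      obtain ⟨σ, hσf, hσ⟩ := ih
      refine ⟨Equiv.swap (σ (c j)) (x j) * σ, fun v => ?_, ?_⟩
      · rw [Equiv.Perm.mul_apply, Equiv.swap_apply_def]
        split_ifs with h1 h2
        · rw [hf, ← hσf (c j), ← h1, hσf]
        · rw [hσf, ← hf, ← h2, hσf]
        · exact hσf v
      · rintro i (rfl | hi)
        · rw [Equiv.Perm.mul_apply, Equiv.swap_apply_left]
        · have hij : i ≠ j := fun h => hj (h ▸ hi)
          rw [Equiv.Perm.mul_apply, Equiv.swap_apply_of_ne_of_ne, hσ i hi]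
          · exact fun h => hij (hc (σ.injective h))
          · rw [hσ i hi]
            exact hx.ne hij
  obtain ⟨σ, hσf, hσ⟩ := key Set.univ Set.finite_univ
  exact ⟨σ, hσf, fun i => hσ i trivial⟩

theorem mem_closedNbhd_map {H : SimpleGraph V} {σ : Equiv.Perm V} {u v : V} :
    σ v ∈ closedNbhd (H.map σ.toEmbedding) (σ u) ↔ v ∈ closedNbhd H u := by
  rw [mem_closedNbhd, mem_closedNbhd, σ.injective.eq_iff]
  exact or_congr_right (SimpleGraph.map_adj_apply (f := σ.toEmbedding))

theorem mem_closedNbhd_perm {G : SimpleGraph V} {σ : Equiv.Perm V}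
    (hσ : ∀ v, closedNbhd G (σ v) = closedNbhd G v) {u v : V} :
    σ v ∈ closedNbhd G (σ u) ↔ v ∈ closedNbhd G u := by
  rw [hσ, mem_closedNbhd_comm, hσ, mem_closedNbhd_comm]

theorem IsPtolemaic.of_iso {H K : SimpleGraph V} (e : K ≃g H) (hH : IsPtolemaic H) :
    IsPtolemaic K := by
  -- homomorphisms do not increase distances
  have hle : ∀ {H' K' : SimpleGraph V} (e : H' →g K') {u v : V},
      H'.Reachable u v → K'.dist (e u) (e v) ≤ H'.dist u v := by
    intro H' K' e u v h
    obtain ⟨p, hp⟩ := h.exists_walk_length_eq_dist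
    rw [← hp, ← SimpleGraph.Walk.length_map e]
    exact SimpleGraph.dist_le _
  have hdist : ∀ u v, K.Reachable u v → H.dist (e u) (e v) = K.dist u v := fun u v h => by
    refine (hle e.toHom h).antisymm ?_
    simpa using hle e.symm.toHom (h.map e.toHom)
  intro u v w x huv huw hux
  have key := hH (e u) (e v) (e w) (e x) (huv.map e.toHom) (huw.map e.toHom) (hux.map e.toHom)
  rwa [hdist _ _ huv, hdist _ _ huw, hdist _ _ hux, hdist _ _ (huw.symm.trans hux),
    hdist _ _ (huv.symm.trans hux), hdist _ _ (huv.symm.trans huw)] at key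

theorem IsPtolemaicSquareRoot.map_perm {H G : SimpleGraph V} (hH : IsPtolemaicSquareRoot H G)
    {σ : Equiv.Perm V} (hσ : ∀ v, closedNbhd G (σ v) = closedNbhd G v) :
    IsPtolemaicSquareRoot (H.map σ.toEmbedding) G := by
  refine ⟨hH.1.of_iso (SimpleGraph.Iso.map σ H).symm, ?_⟩
  ext u v
  obtain ⟨u, rfl⟩ := σ.surjective u
  obtain ⟨v, rfl⟩ := σ.surjective v
  have h1 : (square (H.map σ.toEmbedding)).Adj (σ u) (σ v) ↔ (square H).Adj u v := by
    rw [square_adj, square_adj, ← σ.exists_congr_right, σ.injective.ne_iff]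
    simp only [mem_closedNbhd_map]
  have h2 : ∀ {x y}, G.Adj x y ↔ x ≠ y ∧ y ∈ closedNbhd G x := fun {x y} => by
    rw [mem_closedNbhd]
    exact ⟨fun h => ⟨h.ne, .inr h⟩, fun h => h.2.resolve_left h.1.symm⟩
  rw [h1, hH.2, h2, h2, mem_closedNbhd_perm hσ, σ.injective.ne_iff]

theorem IsCenterMap.map_perm {H G : SimpleGraph V} {c x : maximalCliques G → V}
    (hc : IsCenterMap H G c) {σ : Equiv.Perm V} (hσ : ∀ v, closedNbhd G (σ v) = closedNbhd G v)
    (hσc : ∀ C, σ (c C) = x C) : IsCenterMap (H.map σ.toEmbedding) G x := by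
  intro C
  ext v
  obtain ⟨v, rfl⟩ := σ.surjective v
  rw [← hσc, mem_closedNbhd_map, hc, mem_maximalClique_iff C.2, mem_maximalClique_iff C.2, hσ]

theorem ncard_edgeSet_map_perm {H : SimpleGraph V} (σ : Equiv.Perm V) :
    (H.map σ.toEmbedding).edgeSet.ncard = H.edgeSet.ncard :=
  (Nat.card_congr (SimpleGraph.Iso.map σ H).mapEdgeSet).symm

/-! ### The built graph inside a ptolemaic square root with the same centers -/

variable {G K : SimpleGraph V} {x : maximalCliques G → V}

theorem IsPtolemaicSquareRoot.builtGraph_le [Finite V] [Nonempty V] (hK : IsPtolemaicSquareRoot K G)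
    (hx : IsCenterMap K G x) : builtGraph G x ≤ K := by
  refine sup_le hK.gemTripleGraph_le fun u v huv => ?_
  obtain ⟨hne, ⟨C, hu, rfl⟩ | ⟨C, hv, rfl⟩⟩ := (SimpleGraph.fromRel_adj _ _ _).1 huv
  · rw [← hx C] at hu
    exact ((mem_closedNbhd.1 hu).resolve_left hne).symm
  · rw [← hx C] at hv
    exact (mem_closedNbhd.1 hv).resolve_left hne.symm

theorem IsPtolemaicSquareRoot.isCenterMap_builtGraph [Finite V] [Nonempty V]
    (hK : IsPtolemaicSquareRoot K G) (hx : IsCenterMap K G x) :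
    IsCenterMap (builtGraph G x) G x := by
  refine fun C => Set.Subset.antisymm
    ((closedNbhd_mono (hK.builtGraph_le hx) _).trans (hx C).subset) fun v hv => ?_
  rw [mem_closedNbhd, or_iff_not_imp_left]
  exact fun hne => .inr ((SimpleGraph.fromRel_adj _ _ _).2 ⟨Ne.symm hne, .inr ⟨C, hv, rfl⟩⟩)

theorem IsPtolemaicSquareRoot.square_builtGraph [Finite V] [Nonempty V]
    (hK : IsPtolemaicSquareRoot K G) (hx : IsCenterMap K G x) : square (builtGraph G x) = G := by
  refine le_antisymm ((square_mono (hK.builtGraph_le hx)).trans hK.2.le) fun u v huv => ?_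
  obtain ⟨D, hD, hu, hv⟩ := mem_closedNbhd_iff_exists_maximalClique.1
    (mem_closedNbhd.2 (.inr huv))
  have hxD := hK.isCenterMap_builtGraph hx ⟨D, hD⟩
  exact square_adj.2 ⟨huv.ne, x ⟨D, hD⟩, hxD.symm ▸ hu, hxD.symm ▸ hv⟩

/-- Every vertex is dominated by a center. -/
theorem IsPtolemaicSquareRoot.exists_dominating_center [Finite V] (hK : IsPtolemaicSquareRoot K G)
    (hx : IsCenterMap K G x) (u : V) :
    ∃ b ∈ Set.range x, closedNbhd K u ⊆ closedNbhd K b := by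
  obtain ⟨B, hB, hsub⟩ := isClique_subset_maximal (G := G) (S := closedNbhd K u)
    (hK.2 ▸ isClique_closedNbhd_square u)
  exact ⟨x ⟨B, hB⟩, ⟨_, rfl⟩, (hx ⟨B, hB⟩).symm ▸ hsub⟩

theorem IsPtolemaicSquareRoot.builtGraph_adj_of_center [Finite V] [Nonempty V]
    (hK : IsPtolemaicSquareRoot K G) (hx : IsCenterMap K G x) {a v : V}
    (ha : a ∈ Set.range x) (h : K.Adj a v) :
    (builtGraph G x).Adj a v := by
  obtain ⟨C, rfl⟩ := ha
  have hv : v ∈ closedNbhd (builtGraph G x) (x C) := by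
    rw [hK.isCenterMap_builtGraph hx C, ← hx C]
    exact mem_closedNbhd.2 (.inr h)
  exact (mem_closedNbhd.1 hv).resolve_left h.ne.symm

theorem IsPtolemaicSquareRoot.closedNbhd_builtGraph_center [Finite V] [Nonempty V]
    (hK : IsPtolemaicSquareRoot K G) (hx : IsCenterMap K G x) {a : V} (ha : a ∈ Set.range x) :
    closedNbhd (builtGraph G x) a = closedNbhd K a := by
  obtain ⟨C, rfl⟩ := ha
  rw [hx C, hK.isCenterMap_builtGraph hx C]

theorem IsCenterMap.closedNbhd_mem (hx : IsCenterMap K G x) {a : V} (ha : a ∈ Set.range x) :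
    closedNbhd K a ∈ maximalCliques G := by
  obtain ⟨C, rfl⟩ := ha
  exact hx C ▸ C.2

/-- An edge `u v` of `K` belongs to the built graph as soon as `u` is adjacent to two nonadjacent
centers, one of which is adjacent to `v`. -/
theorem IsPtolemaicSquareRoot.builtGraph_adj_of_centers [Finite V] [Nonempty V]
    (hK : IsPtolemaicSquareRoot K G) (hx : IsCenterMap K G x) {a c u v : V}
    (ha : a ∈ Set.range x) (hc : c ∈ Set.range x)
    (hac : c ∉ closedNbhd K a) (hua : u ∈ closedNbhd K a) (huc : u ∈ closedNbhd K c)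
    (hva : v ∈ closedNbhd K a) (huv : K.Adj u v) : (builtGraph G x).Adj u v := by
  obtain ⟨B, hB, hsub⟩ := isClique_subset_maximal (G := G) (S := closedNbhd K u)
    (hK.2 ▸ isClique_closedNbhd_square u)
  have h := hK.isGemTriple (hx.closedNbhd_mem ha) (hx.closedNbhd_mem hc) hB hua huc hac hsub
  exact .inl ((SimpleGraph.fromRel_adj _ _ _).2 ⟨huv.ne, .inl
    ⟨_, _, _, h, ⟨hua, huc⟩, .inl hva, hsub (mem_closedNbhd.2 (.inr huv))⟩⟩)

/-- The edges of the built graph that do not meet a center come from a pair of nonadjacent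
centers. -/
theorem IsPtolemaicSquareRoot.exists_centers_of_builtGraph_adj [Finite V] [Nonempty V]
    (hK : IsPtolemaicSquareRoot K G) (hx : IsCenterMap K G x) {u v : V}
    (hu : u ∉ Set.range x) (hv : v ∉ Set.range x)
    (huv : (builtGraph G x).Adj u v) :
    ∃ a ∈ Set.range x, ∃ c ∈ Set.range x, c ∉ closedNbhd K a ∧ u ∈ closedNbhd K a ∧
      v ∈ closedNbhd K a ∧ (u ∈ closedNbhd K c ∨ v ∈ closedNbhd K c) := by
  have key : ∀ u v, (∃ A B C : Set V, IsGemTriple G A B C ∧ u ∈ A ∩ C ∧ v ∈ (A ∪ C) ∩ B) →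
      ∃ a ∈ Set.range x, ∃ c ∈ Set.range x, c ∉ closedNbhd K a ∧ u ∈ closedNbhd K a ∧
      v ∈ closedNbhd K a ∧ u ∈ closedNbhd K c := by
    rintro u v ⟨A, B, C, h, ⟨huA, huC⟩, hvAC, -⟩
    have hA := hx ⟨A, h.left_mem⟩
    have hB := hx ⟨B, h.mid_mem⟩
    have hC := hx ⟨C, h.right_mem⟩
    dsimp only at hA hB hC
    have hnot : x ⟨C, h.right_mem⟩ ∉ closedNbhd K (x ⟨A, h.left_mem⟩) :=
      hK.1.notMem_of_isGemTriple (b := x ⟨B, h.mid_mem⟩) (by rwa [hA, hB, hC])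
    rcases hvAC with hv | hv
    · exact ⟨_, ⟨_, rfl⟩, _, ⟨_, rfl⟩, hnot, hA.ge huA, hA.ge hv, hC.ge huC⟩
    · exact ⟨_, ⟨_, rfl⟩, _, ⟨_, rfl⟩, mt mem_closedNbhd_comm.1 hnot, hC.ge huC, hC.ge hv,
        hA.ge huA⟩
  rcases huv with huv | huv
  · obtain ⟨-, h | h⟩ := (SimpleGraph.fromRel_adj _ _ _).1 huv
    · obtain ⟨a, ha, c, hc, hac, hua, hva, huc⟩ := key u v h
      exact ⟨a, ha, c, hc, hac, hua, hva, .inl huc⟩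
    · obtain ⟨a, ha, c, hc, hac, hva, hua, hvc⟩ := key v u h
      exact ⟨a, ha, c, hc, hac, hua, hva, .inr hvc⟩
  · obtain ⟨-, ⟨C, -, h⟩ | ⟨C, -, h⟩⟩ := (SimpleGraph.fromRel_adj _ _ _).1 huv
    · exact absurd ⟨C, h.symm⟩ hv
    · exact absurd ⟨C, h.symm⟩ hu

/-- `u v` is an edge of `K` that is missing in the subgraph `H`. -/
def IsLight (K H : SimpleGraph V) (u v : V) : Prop :=
  K.Adj u v ∧ ¬ H.Adj u v

theorem IsLight.symm {H : SimpleGraph V} {u v : V} (h : IsLight K H u v) : IsLight K H v u :=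
  ⟨h.1.symm, fun h' => h.2 h'.symm⟩

/-! ### Light edges -/

theorem IsLight.notMem_range [Finite V] [Nonempty V] {u v : V}
    (h : IsLight K (builtGraph G x) u v) (hK : IsPtolemaicSquareRoot K G) (hx : IsCenterMap K G x) :
    u ∉ Set.range x :=
  fun hu => h.2 (hK.builtGraph_adj_of_center hx hu h.1)

/-- The centers that are adjacent to both ends of a light edge are adjacent to all centers that are
adjacent to one of its ends. -/
theorem IsLight.mem_closedNbhd_of_centers [Finite V] [Nonempty V] {u v a c : V}
    (h : IsLight K (builtGraph G x) u v) (hK : IsPtolemaicSquareRoot K G) (hx : IsCenterMap K G x)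
    (ha : a ∈ Set.range x) (hc : c ∈ Set.range x) (hua : u ∈ closedNbhd K a)
    (hva : v ∈ closedNbhd K a) (huc : u ∈ closedNbhd K c) : c ∈ closedNbhd K a := by
  by_contra hac
  exact h.2 (hK.builtGraph_adj_of_centers hx ha hc hac hua huc hva h.1)

/-- A center that is adjacent to both ends of a light edge dominates them in the built graph. -/
theorem IsLight.closedNbhd_subset_of_center [Finite V] [Nonempty V] {u v b : V}
    (h : IsLight K (builtGraph G x) u v) (hK : IsPtolemaicSquareRoot K G) (hx : IsCenterMap K G x)
    (hb : b ∈ Set.range x) (hub : u ∈ closedNbhd K b) (hvb : v ∈ closedNbhd K b) :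
    closedNbhd (builtGraph G x) u ⊆ closedNbhd K b := by
  intro y hy
  rcases mem_closedNbhd.1 hy with rfl | huy
  · exact hub
  have hKuy := hK.builtGraph_le hx huy
  by_cases hyx : y ∈ Set.range x
  · exact h.mem_closedNbhd_of_centers hK hx hb hyx hub hvb (mem_closedNbhd.2 (.inr hKuy.symm))
  have key : ∀ a ∈ Set.range x, ∀ c ∈ Set.range x, c ∉ closedNbhd K a → u ∈ closedNbhd K a →
      u ∈ closedNbhd K c → y ∈ closedNbhd K a → y ∈ closedNbhd K b := by
    intro a ha c hc hac hua huc hya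
    have hba := h.mem_closedNbhd_of_centers hK hx hb ha hub hvb hua
    have hbc := h.mem_closedNbhd_of_centers hK hx hb hc hub hvb huc
    rcases hK.1.chord (mem_closedNbhd_comm.1 hbc) hba hya (mem_closedNbhd_comm.1 huc)
      (mem_closedNbhd.2 (.inr hKuy)) with h' | h'
    exacts [absurd (mem_closedNbhd_comm.1 h') hac, h']
  obtain ⟨a, ha, c, hc, hac, hua, hya, huyc⟩ :=
    hK.exists_centers_of_builtGraph_adj hx (h.notMem_range hK hx) hyx huy
  by_cases huc : u ∈ closedNbhd K c
  · exact key a ha c hc hac hua huc hya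
  have hyc := huyc.resolve_left huc
  obtain ⟨d, hd, hsub⟩ := hK.exists_dominating_center hx y
  have hud := hsub (mem_closedNbhd.2 (.inr hKuy.symm))
  have hbd := h.mem_closedNbhd_of_centers hK hx hb hd hub hvb hud
  rcases hK.1.chord hyc (mem_closedNbhd.2 (.inr hKuy.symm)) (mem_closedNbhd_comm.1 hub)
    (hsub (mem_closedNbhd_comm.1 hyc)) (mem_closedNbhd_comm.1 hbd) with h' | h'
  exacts [absurd h' huc, mem_closedNbhd_comm.1 h']

/-- A common neighbour in the built graph of the ends of a light edge dominates them. -/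
theorem IsLight.closedNbhd_subset_of_common [Finite V] [Nonempty V] {u v w : V}
    (h : IsLight K (builtGraph G x) u v) (hK : IsPtolemaicSquareRoot K G) (hx : IsCenterMap K G x)
    (hw : w ∈ closedNbhd (builtGraph G x) u) (hw' : w ∈ closedNbhd (builtGraph G x) v) :
    closedNbhd (builtGraph G x) u ⊆ closedNbhd (builtGraph G x) w := by
  have huw : (builtGraph G x).Adj u w := (mem_closedNbhd.1 hw).resolve_left fun e =>
    h.symm.2 ((mem_closedNbhd.1 (e ▸ hw')).resolve_left h.1.ne)
  have hvw : (builtGraph G x).Adj v w := (mem_closedNbhd.1 hw').resolve_left fun e =>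
    h.2 ((mem_closedNbhd.1 (e ▸ hw)).resolve_left h.1.ne.symm)
  have hle := hK.builtGraph_le hx
  have hKuw : w ∈ closedNbhd K u := mem_closedNbhd.2 (.inr (hle huw))
  have hKvw : w ∈ closedNbhd K v := mem_closedNbhd.2 (.inr (hle hvw))
  by_cases hwx : w ∈ Set.range x
  · rw [hK.closedNbhd_builtGraph_center hx hwx]
    exact h.closedNbhd_subset_of_center hK hx hwx (mem_closedNbhd_comm.1 hKuw)
      (mem_closedNbhd_comm.1 hKvw)
  -- the edges `u w` and `v w` come from nonadjacent centers, one of which can be taken near both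
  -- `u` and `v`
  obtain ⟨a, ha, c, hc, hac, hua, hva, hwa, hwc⟩ : ∃ a ∈ Set.range x, ∃ c ∈ Set.range x,
      c ∉ closedNbhd K a ∧ u ∈ closedNbhd K a ∧ v ∈ closedNbhd K a ∧ w ∈ closedNbhd K a ∧
        w ∈ closedNbhd K c := by
    obtain ⟨a, ha, c, hc, hac, hua, hwa, h1⟩ :=
      hK.exists_centers_of_builtGraph_adj hx (h.notMem_range hK hx) hwx huw
    obtain ⟨a', ha', c', hc', hac', hva', hwa', h2⟩ :=
      hK.exists_centers_of_builtGraph_adj hx (h.symm.notMem_range hK hx) hwx hvw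
    by_cases hva : v ∈ closedNbhd K a
    · exact ⟨a, ha, c, hc, hac, hua, hva, hwa, h1.resolve_left fun huc =>
        hac (h.mem_closedNbhd_of_centers hK hx ha hc hua hva huc)⟩
    by_cases hua' : u ∈ closedNbhd K a'
    · exact ⟨a', ha', c', hc', hac', hua', hva', hwa', h2.resolve_left fun hvc =>
        hac' (h.symm.mem_closedNbhd_of_centers hK hx ha' hc' hva' hua' hvc)⟩
    rcases hK.1.chord hua (mem_closedNbhd.2 (.inr h.1)) (mem_closedNbhd_comm.1 hva')
      (mem_closedNbhd_comm.1 hwa) (mem_closedNbhd_comm.1 hwa') with h' | h'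
    exacts [absurd h' hva, absurd (mem_closedNbhd_comm.1 h') hua']
  have huc : u ∉ closedNbhd K c := fun huc =>
    hac (h.mem_closedNbhd_of_centers hK hx ha hc hua hva huc)
  obtain ⟨b, hb, hsub⟩ := hK.exists_dominating_center hx w
  have hub := hsub (mem_closedNbhd_comm.1 hKuw)
  have hvb := hsub (mem_closedNbhd_comm.1 hKvw)
  intro y hy
  have hyb := h.closedNbhd_subset_of_center hK hx hb hub hvb hy
  have hya := h.closedNbhd_subset_of_center hK hx ha hua hva hy
  have hKuy := closedNbhd_mono hle _ hy
  have hwy : y ∈ closedNbhd K w := by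
    rcases hK.1.chord (mem_closedNbhd_comm.1 hKuy) hKuw (mem_closedNbhd_comm.1 hwc) hyb
      (hsub (mem_closedNbhd_comm.1 hwc)) with h' | h'
    exacts [mem_closedNbhd_comm.1 h', absurd (mem_closedNbhd_comm.1 h') huc]
  refine mem_closedNbhd.2 ((mem_closedNbhd.1 hwy).imp_right fun hwy => ?_)
  by_contra hcon
  exact hac (IsLight.mem_closedNbhd_of_centers ⟨hwy, hcon⟩ hK hx ha hc hwa hya hwc)

/-! ### Distances in the built graph -/

theorem reachable_and_dist_le_two {H : SimpleGraph V} {u v z : V} (hu : u ∈ closedNbhd H z)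
    (hv : v ∈ closedNbhd H z) : H.Reachable u v ∧ H.dist u v ≤ 2 := by
  have h1 := dist_le_one_of_mem_closedNbhd (mem_closedNbhd_comm.1 hu)
  have h2 := dist_le_one_of_mem_closedNbhd hv
  have hr := reachable_of_mem_closedNbhd (mem_closedNbhd_comm.1 hu)
  have := hr.dist_triangle_left v
  exact ⟨hr.trans (reachable_of_mem_closedNbhd hv), by omega⟩

/-- A path of length two in `K` can be replaced by one through a center. -/
theorem IsPtolemaicSquareRoot.dist_builtGraph_le_two [Finite V] [Nonempty V]
    (hK : IsPtolemaicSquareRoot K G) (hx : IsCenterMap K G x) {u v z : V}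
    (hu : u ∈ closedNbhd K z) (hv : v ∈ closedNbhd K z) :
    (builtGraph G x).Reachable u v ∧ (builtGraph G x).dist u v ≤ 2 := by
  obtain ⟨b, hb, hsub⟩ := hK.exists_dominating_center hx z
  rw [← hK.closedNbhd_builtGraph_center hx hb] at hsub
  exact reachable_and_dist_le_two (hsub hu) (hsub hv)

/-- The light edges are the only pairs of vertices whose distance in the built graph is larger than
in `K`. -/
theorem IsPtolemaicSquareRoot.dist_builtGraph_le [Finite V] [Nonempty V]
    (hK : IsPtolemaicSquareRoot K G) (hx : IsCenterMap K G x) (n : ℕ) :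
    ∀ {u v : V} (p : K.Walk u v), p.length = n → p.length = K.dist u v →
      ¬ IsLight K (builtGraph G x) u v →
      (builtGraph G x).Reachable u v ∧ (builtGraph G x).dist u v ≤ n := by
  induction n using Nat.strong_induction_on with
  | _ n ih =>
    intro u v p hpn hp hlight
    match p with
    | .nil => simp
    | .cons (v := v₁) h₁ .nil =>
      have : (builtGraph G x).Adj u v₁ := by
        by_contra hcon
        exact hlight ⟨h₁, hcon⟩
      exact ⟨this.reachable, by
        rw [SimpleGraph.dist_eq_one_iff_adj.2 this, ← hpn]
        simp⟩
    | .cons (v := v₁) h₁ (.cons (v := v₂) h₂ q) =>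
      rw [SimpleGraph.Walk.length_cons, SimpleGraph.Walk.length_cons] at hpn hp
      obtain ⟨hr2, hd2⟩ := hK.dist_builtGraph_le_two hx (u := u) (v := v₂) (z := v₁)
        (mem_closedNbhd.2 (.inr h₁.symm)) (mem_closedNbhd.2 (.inr h₂))
      have hq : q.length = K.dist v₂ v := by
        have h1 := SimpleGraph.dist_le q
        have h2 := h₁.reachable.dist_triangle_left v
        have h3 := h₂.reachable.dist_triangle_left v
        rw [SimpleGraph.dist_eq_one_iff_adj.2 h₁] at h2
        rw [SimpleGraph.dist_eq_one_iff_adj.2 h₂] at h3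
        omega
      by_cases hl : IsLight K (builtGraph G x) v₂ v
      · -- a geodesic `u v₁ v₂ v` that ends in a light edge: go through a center near `u` and `v₂`
        -- and a center near `v₂` and `v`
        have hq1 : q.length = 1 := hq.trans (SimpleGraph.dist_eq_one_iff_adj.2 hl.1)
        obtain ⟨a, ha, hasub⟩ := hK.exists_dominating_center hx v₁
        obtain ⟨b, hb, hbsub⟩ := hK.exists_dominating_center hx v
        have hua := hasub (mem_closedNbhd.2 (.inr h₁.symm))
        have h2a := hasub (mem_closedNbhd.2 (.inr h₂))
        have h2b := hbsub (mem_closedNbhd.2 (.inr hl.1.symm))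
        have hvb := hbsub self_mem_closedNbhd
        have hab := hl.mem_closedNbhd_of_centers hK hx hb ha h2b hvb h2a
        rw [← hK.closedNbhd_builtGraph_center hx ha] at hua
        rw [← hK.closedNbhd_builtGraph_center hx hb] at hvb hab
        obtain ⟨hr, hd⟩ := reachable_and_dist_le_two hab hvb
        have h3 := (reachable_of_mem_closedNbhd (mem_closedNbhd_comm.1 hua)).dist_triangle_left v
        have h4 := dist_le_one_of_mem_closedNbhd (mem_closedNbhd_comm.1 hua)
        exact ⟨(reachable_of_mem_closedNbhd (mem_closedNbhd_comm.1 hua)).trans hr, by omega⟩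
      · obtain ⟨hr, hd⟩ := ih q.length (by omega) q rfl hq hl
        have := hr2.dist_triangle_left v
        exact ⟨hr2.trans hr, by omega⟩

/-- The ptolemaic inequality for four distinct vertices `u, v, w, x` when `u v` is light. The
distances of `w` and of `x` to the ends of `u v` are `α, α'` and `β, β'`. -/
theorem two_mul_le_of_light {α α' β β' D : ℕ} (hα : 1 ≤ α) (hα' : 1 ≤ α') (hβ : 1 ≤ β)
    (hβ' : 1 ≤ β') (h1 : D ≤ α + β) (h2 : D ≤ α' + β') (h3 : α' ≤ α + 1) (h4 : α ≤ α' + 1)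
    (h5 : β' ≤ β + 1) (h6 : β ≤ β' + 1) (hw : α = 1 → α' = 1 → D ≤ β ∧ D ≤ β')
    (hx : β = 1 → β' = 1 → D ≤ α ∧ D ≤ α') (hwx : α = 1 → β' = 1 → D ≤ 2)
    (hxw : α' = 1 → β = 1 → D ≤ 2) : 2 * D ≤ α * β' + β * α' := by
  have large : ∀ {a b : ℕ}, 2 ≤ a → 2 ≤ b → a + b ≤ a * b := fun {a b} ha hb => by nlinarith
  have small : ∀ {a : ℕ}, 1 ≤ a → a ≤ 1 + 1 → a = 1 ∨ a = 2 := by omega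
  by_cases ha : α = 1
  · subst ha
    obtain rfl | rfl := small hα' h3 <;> omega
  by_cases ha' : α' = 1
  · subst ha'
    obtain rfl : α = 2 := by omega
    omega
  by_cases hb : β = 1
  · subst hb
    obtain rfl | rfl := small hβ' h5 <;> omega
  by_cases hb' : β' = 1
  · subst hb'
    obtain rfl : β = 2 := by omega
    omega
  have := large (a := α) (b := β') (by omega) (by omega)
  have := large (a := β) (b := α') (by omega) (by omega)
  omega

theorem IsPtolemaicSquareRoot.isPtolemaic_builtGraph [Finite V] [Nonempty V]
    (hK : IsPtolemaicSquareRoot K G) (hx : IsCenterMap K G x) : IsPtolemaic (builtGraph G x) := by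
  have hle := hK.builtGraph_le hx
  set H := builtGraph G x with hH
  have hdist : ∀ {u v}, H.Reachable u v → ¬ IsLight K H u v → H.dist u v = K.dist u v := by
    intro u v hr hl
    obtain ⟨p, hp⟩ := (hr.mono hle).exists_walk_length_eq_dist
    refine le_antisymm ?_ (hr.dist_anti hle)
    rw [← hp]
    exact (hK.dist_builtGraph_le hx p.length p rfl hp hl).2
  have light : ∀ {u v}, IsLight K H u v → ∀ w y, H.Reachable u w → H.Reachable u y →
      H.dist u v * H.dist w y ≤ H.dist u w * H.dist v y + H.dist u y * H.dist v w := by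
    intro u v h w y huw huy
    obtain ⟨b, hb, hub⟩ := hK.exists_dominating_center hx u
    have hvb := hub (mem_closedNbhd.2 (.inr h.1))
    have hub := hub self_mem_closedNbhd
    have hsubu := h.closedNbhd_subset_of_center hK hx hb hub hvb
    have hsubv := h.symm.closedNbhd_subset_of_center hK hx hb hvb hub
    rw [← hK.closedNbhd_builtGraph_center hx hb, ← hH] at hub hvb hsubu hsubv
    obtain ⟨huv, hduv⟩ := reachable_and_dist_le_two hub hvb
    have hvw := huv.symm.trans huw
    have hvy := huv.symm.trans huy
    rcases eq_or_ne w u with rfl | hwu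
    · rw [SimpleGraph.dist_self, zero_mul, zero_add, mul_comm, H.dist_comm (u := w) (v := v)]
    rcases eq_or_ne w v with rfl | hwv
    · rw [SimpleGraph.dist_self, mul_zero, add_zero]
    rcases eq_or_ne y u with rfl | hyu
    · rw [SimpleGraph.dist_self, zero_mul, add_zero, mul_comm, H.dist_comm (u := w) (v := y),
        H.dist_comm (u := y) (v := v)]
    rcases eq_or_ne y v with rfl | hyv
    · rw [SimpleGraph.dist_self, mul_zero, zero_add, H.dist_comm (u := w)]
    -- rerouting through `b` compares the distances to `u` and to `v`
    have near : ∀ {z}, z ≠ u → z ≠ v → H.Reachable u z →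
        H.dist v z ≤ H.dist u z + 1 ∧ H.dist u z ≤ H.dist v z + 1 := by
      intro z hzu hzv huz
      have h1 := dist_le_dist_of_closedNbhd_subset hsubu hzu huz
      have h2 := dist_le_dist_of_closedNbhd_subset hsubv hzv (huv.symm.trans huz)
      have h3 := (reachable_of_mem_closedNbhd (mem_closedNbhd_comm.1 hub)).dist_triangle_left z
      have h4 := (reachable_of_mem_closedNbhd (mem_closedNbhd_comm.1 hvb)).dist_triangle_left z
      have h5 := dist_le_one_of_mem_closedNbhd (mem_closedNbhd_comm.1 hub)
      have h6 := dist_le_one_of_mem_closedNbhd (mem_closedNbhd_comm.1 hvb)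
      omega
    have one : ∀ {p q}, H.Reachable p q → H.dist p q = 1 → q ∈ closedNbhd H p := fun hr h1 =>
      (mem_closedNbhd_iff_dist_le_one hr).2 h1.le
    have common : ∀ {z z'}, z' ≠ u → z' ≠ v → H.Reachable u z → H.Reachable u z' →
        H.dist u z = 1 → H.dist v z = 1 →
          H.dist z z' ≤ H.dist u z' ∧ H.dist z z' ≤ H.dist v z' := by
      intro z z' hu hv huz huz' h1 h2
      have h1 := one huz h1
      have h2 := one (huv.symm.trans huz) h2
      exact ⟨dist_le_dist_of_closedNbhd_subset (h.closedNbhd_subset_of_common hK hx h1 h2) hu huz',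
        dist_le_dist_of_closedNbhd_subset (h.symm.closedNbhd_subset_of_common hK hx h2 h1) hv
          (huv.symm.trans huz')⟩
    refine (Nat.mul_le_mul_right _ hduv).trans (two_mul_le_of_light
      (huw.pos_dist_of_ne hwu.symm) (hvw.pos_dist_of_ne hwv.symm) (huy.pos_dist_of_ne hyu.symm)
      (hvy.pos_dist_of_ne hyv.symm) ?_ ?_ (near hwu hwv huw).1 (near hwu hwv huw).2
      (near hyu hyv huy).1 (near hyu hyv huy).2 (common hyu hyv huw huy) ?_ ?_ ?_)
    · rw [H.dist_comm (u := u) (v := w)]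
      exact huw.symm.dist_triangle_left y
    · rw [H.dist_comm (u := v) (v := w)]
      exact hvw.symm.dist_triangle_left y
    · rw [H.dist_comm (u := w)]
      exact common hwu hwv huy huw
    · exact fun h1 h2 => (reachable_and_dist_le_two (hsubu (one huw h1)) (hsubv (one hvy h2))).2
    · exact fun h1 h2 => (reachable_and_dist_le_two (hsubv (one hvw h1)) (hsubu (one huy h2))).2
  intro u v w y huv huw huy
  by_cases h1 : IsLight K H u v
  · exact light h1 w y huw huy
  by_cases h2 : IsLight K H w y
  · have := light h2 u v huw.symm (huw.symm.trans huv)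
    rw [H.dist_comm (u := w) (v := u), H.dist_comm (u := y) (v := v), H.dist_comm (u := w) (v := v),
      H.dist_comm (u := y) (v := u), mul_comm (H.dist v w)] at this
    rwa [mul_comm]
  · rw [hdist huv h1, hdist (huw.symm.trans huy) h2]
    refine (hK.1 u v w y (huv.mono hle) (huw.mono hle) (huy.mono hle)).trans ?_
    have hvw := huv.symm.trans huw
    have hvy := huv.symm.trans huy
    exact add_le_add (Nat.mul_le_mul (huw.dist_anti hle) (hvy.dist_anti hle))
      (Nat.mul_le_mul (huy.dist_anti hle) (hvw.dist_anti hle))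

end PtolemaicRoot

theorem lemma8 {V : Type*} [Finite V] [Nonempty V] (G : SimpleGraph V)
    (hG : ∃ H₀ : SimpleGraph V, IsPtolemaicSquareRoot H₀ G) :
    -- the algorithm returns something, and
    (∃ r, AlgorithmReturns G r) ∧
    -- whatever it returns, for whichever choice of the assignment, is as claimed
    ∀ r, AlgorithmReturns G r →
      ∃ (x : maximalCliques G → V) (H : SimpleGraph V),
        IsCenterAssignment G x ∧ H = builtGraph G x ∧ r = some H ∧
        -- a ptolemaic square root with the minimum number of edges
        IsPtolemaicSquareRoot H G ∧
        (∀ H' : SimpleGraph V, IsPtolemaicSquareRoot H' G →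
          H.edgeSet.ncard ≤ H'.edgeSet.ncard) ∧
        IsChordal H ∧ IsGemFree H ∧
        -- every edge is a gem-triple edge or a center edge
        (∀ C : maximalCliques G, closedNbhd H (x C) = C) ∧
        (∀ u v : V, H.Adj u v ↔ (gemTripleGraph G).Adj u v ∨ (centerGraph G x).Adj u v) ∧
        -- these edges are forced, the center edges up to relabeling adjacent twins of `G`
        (∀ H' : SimpleGraph V, IsPtolemaicSquareRoot H' G →
          (∀ u v : V, (gemTripleGraph G).Adj u v → H'.Adj u v) ∧
          (∃ σ : Equiv.Perm V,
            (∀ v : V, closedNbhd G (σ v) = closedNbhd G v) ∧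
            IsPtolemaicSquareRoot (H'.map σ.toEmbedding) G ∧
            (∀ C : maximalCliques G, closedNbhd (H'.map σ.toEmbedding) (x C) = C) ∧
            ∀ u v : V, H.Adj u v → (H'.map σ.toEmbedding).Adj u v) ∧
          (H'.Connected → H.Connected)) := by
 
  obtain ⟨H₀, hH₀⟩ := hG
  have main : ∀ x, IsCenterAssignment G x → ∀ H', IsPtolemaicSquareRoot H' G →
      ∃ σ : Equiv.Perm V, (∀ v, closedNbhd G (σ v) = closedNbhd G v) ∧
        IsPtolemaicSquareRoot (H'.map σ.toEmbedding) G ∧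
        IsCenterMap (H'.map σ.toEmbedding) G x := by
    intro x hx H' hH'
    obtain ⟨c, hc⟩ := hH'.exists_isCenterMap
    obtain ⟨σ, hσ, hσc⟩ := exists_perm_of_injective (closedNbhd G) hc.injective hx.1 fun C =>
      closedNbhd_eq_of_mem_centerCandidates C.2 (hx.2 C) ((hH'.isCenterAssignment hc).2 C)
    exact ⟨σ, hσ, hH'.map_perm hσ, hc.map_perm hσ hσc⟩
  have root : ∀ x, IsCenterAssignment G x →
      IsPtolemaicSquareRoot (builtGraph G x) G ∧ IsCenterMap (builtGraph G x) G x := by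
    intro x hx
    obtain ⟨σ, -, hK, hKx⟩ := main x hx H₀ hH₀
    exact ⟨⟨hK.isPtolemaic_builtGraph hKx, hK.square_builtGraph hKx⟩,
      hK.isCenterMap_builtGraph hKx⟩
  have assignment : ∃ x, IsCenterAssignment G x := by
    obtain ⟨c, hc⟩ := hH₀.exists_isCenterMap
    exact ⟨c, hH₀.isCenterAssignment hc⟩
  constructor
  · obtain ⟨x, hx⟩ := assignment
    exact ⟨_, .check_succeeds x hH₀.isChordal hx (root x hx).1⟩
  · intro r hr
    cases hr with
    | not_chordal h => exact absurd hH₀.isChordal h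
    | no_assignment _ h => exact absurd assignment h
    | check_fails x _ hx h => exact absurd (root x hx).1 h
    | check_succeeds x _ hx _ =>
      obtain ⟨hH, hHx⟩ := root x hx
      refine ⟨x, _, hx, rfl, rfl, hH, fun H' hH' => ?_, hH.1.isChordal, hH.1.isGemFree, hHx,
        fun u v => Iff.rfl, fun H' hH' => ⟨fun u v h => hH'.gemTripleGraph_le h, ?_, fun h => ?_⟩⟩
      · obtain ⟨σ, -, hK, hKx⟩ := main x hx H' hH'
        rw [← ncard_edgeSet_map_perm (H := H') σ]
        exact Set.ncard_le_ncard (SimpleGraph.edgeSet_mono (hK.builtGraph_le hKx)) (Set.toFinite _)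
      · obtain ⟨σ, hσ, hK, hKx⟩ := main x hx H' hH'
        exact ⟨σ, hσ, hK, hKx, fun u v h => hK.builtGraph_le hKx h⟩
      · -- both graphs have the components of `G`
        refine ⟨fun u v => ?_⟩
        rw [← reachable_square_iff, hH.2, ← hH'.2, reachable_square_iff]
        exact h.preconnected u v
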